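/- Let $\sigma,\Theta,\gamma>0$ and $\Gamma=\sigma^2\Theta$ (average SNR per port or branch), let $L\ge 2$ be an integer, $\kappa>1$, and $$\varrho=\frac{e^{1/(\pi(\kappa-1)+2)}}{2\kappa}\sqrt{\frac{(\kappa-1)(\pi(\kappa-1)+2)}{\pi}} .$$ *FAS.* For $N\ge2$ and $W\ge0$ let $x_0,\dots,x_N,y_0,\dots,y_N$ be independent real Gaussian variables of mean $0$ and variance $\tfrac12$, let $J_0$ be the Bessel function of the first kind of order zero, $\mu_k=J_0\!\left(\frac{2\pi(k-1)}{N-1}W\right)$ for $2\le k\le N$, $g_1=\sigma(x_0+jy_0)$ and $$g_k=\sigma\left(\sqrt{1-\mu_k^2}\,x_k+\mu_kx_0\right)+j\sigma\left(\sqrt{1-\mu_k^2}\,y_k+\mu_ky_0\right)\quad(2\le k\le N).$$ The outage probability of the $N$-port fluid antenna system of size $W$ (in wavelengths) is $p_{\rm FAS}(N,W)=\Pr\big(\max_{1\le k\le N}|g_k|^2\,\Theta<\gamma\big)$. *MRC.* Let $h_1,\dots,h_L$ be independent circularly symmetric complex Gaussian variables of mean $0$ and variance $\sigma^2$. The outage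 probability of the $L$-antenna maximal ratio combining receiver is $p_{\rm MRC}=\Pr\big(\Theta\sum_{l=1}^L|h_l|^2<\gamma\big)$. For $0<\mu<1$ let $J_0^{-1}(\mu)$ denote the smallest $\varepsilon\ge0$ such that $|J_0(t)|\le\mu$ for all $t\ge\varepsilon$. Then there is $N_0$, depending only on $\sigma,\Theta,\gamma,L,\kappa$, such that for every integer $N\ge N_0$ (so $N>2$) the number $$W^*_N=\frac1{2\pi}J_0^{-1}\!\left(\sqrt{1-\frac{\kappa\,\gamma/\Gamma}{\ln\!\left(\dfrac{\varrho}{1-\left(\frac{p_{\rm MRC}}{1-e^{-\gamma/\Gamma}}\right)^{1/(N/2-1)}}\right)}}\right)$$ is well defined (the denominator $1-(\cdot)^{1/(N/2-1)}$ is positive, the logarithm exceeds $\kappa\gamma/\Gamma$, and the minimum defining $J_0^{-1}$ is attained), and for every $W\ge W^*_N$ the fluid antenna system outperforms the MRC receiver: $p_{\rm FAS}(N,W)<p_{\rm MRC}$. -/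

import Mathlib

open MeasureTheory ProbabilityTheory
open scoped NNReal

noncomputable section

namespace FluidAntenna

/-! ### Special functions and constants -/

/-- The Bessel function of the first kind of order zero, through Bessel's integral
`J₀(x) = (1/π) ∫₀^π cos (x sin θ) dθ`. -/
def besselJ0 (x : ℝ) : ℝ :=
  (1 / Real.pi) * ∫ θ in (0 : ℝ)..Real.pi, Real.cos (x * Real.sin θ)

/-- The set of `ε ≥ 0` beyond which `|J₀|` stays at or below the level `μ`. -/
def besselJ0LevelSet (μ : ℝ) : Set ℝ :=
  {ε | 0 ≤ ε ∧ ∀ t, ε ≤ t → |besselJ0 t| ≤ μ}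

/-- `J₀⁻¹(μ)`: the smallest `ε ≥ 0` such that `|J₀(t)| ≤ μ` for all `t ≥ ε`. -/
def besselJ0Inv (μ : ℝ) : ℝ := sInf (besselJ0LevelSet μ)

/-- The constant `ϱ` attached to `κ > 1`. -/
def rho (κ : ℝ) : ℝ :=
  Real.exp (1 / (Real.pi * (κ - 1) + 2)) / (2 * κ) *
    Real.sqrt ((κ - 1) * (Real.pi * (κ - 1) + 2) / Real.pi)

/-! ### The fading model -/

/-- The law of a pair `(x, y)` of independent real Gaussians of mean `0` and variance `1/2`. -/
def pairLaw : Measure (ℝ × ℝ) :=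
  (gaussianReal 0 (1 / 2 : ℝ≥0)).prod (gaussianReal 0 (1 / 2 : ℝ≥0))

/-- The joint law of `n` independent such pairs. -/
def pairsLaw (n : ℕ) : Measure (Fin n → ℝ × ℝ) :=
  Measure.pi fun _ => pairLaw

/-- The average received signal-to-noise ratio `Γ = σ² Θ`, where `Θ` is the ratio of the transmit
energy to the noise variance. -/
def avgSNR (σ Θ : ℝ) : ℝ := σ ^ 2 * Θ

/-! ### The `N`-port fluid antenna system of size `W` wavelengths

Ports are numbered from `0`: `i : Fin N` is the `(i + 1)`-st port. A sample point
`ω : Fin (N + 1) → ℝ × ℝ` lists the pairs `(x₀, y₀), …, (x_N, y_N)`. -/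

/-- The correlation parameter of the port `i`, at distance `i W / (N - 1)` wavelengths from the
first port. -/
def portCorr (N : ℕ) (W : ℝ) (i : Fin N) : ℝ :=
  besselJ0 (2 * Real.pi * (i : ℝ) / ((N : ℝ) - 1) * W)

/-- The complex channel gain of the port `i`. -/
def portGain (N : ℕ) (W σ : ℝ) (i : Fin N) (ω : Fin (N + 1) → ℝ × ℝ) : ℂ :=
  if (i : ℕ) = 0 then ⟨σ * (ω 0).1, σ * (ω 0).2⟩
  else
    ⟨σ * (Real.sqrt (1 - portCorr N W i ^ 2) * (ω i.succ).1 + portCorr N W i * (ω 0).1),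
      σ * (Real.sqrt (1 - portCorr N W i ^ 2) * (ω i.succ).2 + portCorr N W i * (ω 0).2)⟩

/-- The envelope at the selected port, `|g_FAS| = max {|g₁|, …, |g_N|}`. -/
def fasEnvelope (N : ℕ) (W σ : ℝ) (ω : Fin (N + 1) → ℝ × ℝ) : ℝ :=
  ⨆ i : Fin N, ‖portGain N W σ i ω‖

/-- The outage probability of the fluid antenna system at the SNR threshold `γ`. -/
def fasOutage (N : ℕ) (W σ Θ γ : ℝ) : ℝ :=
  (pairsLaw (N + 1)).real {ω | fasEnvelope N W σ ω ^ 2 * Θ < γ}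

/-! ### The `L`-antenna maximal ratio combining receiver with independent fading -/

/-- The complex channel gain of the branch `j`. -/
def branchGain (L : ℕ) (σ : ℝ) (j : Fin L) (ω : Fin L → ℝ × ℝ) : ℂ :=
  ⟨σ * (ω j).1, σ * (ω j).2⟩

/-- The outage probability of maximal ratio combining: the SNR after combining is the sum of the
SNRs of the branches. -/
def mrcOutage (L : ℕ) (σ Θ γ : ℝ) : ℝ :=
  (pairsLaw L).real {ω | (∑ j : Fin L, ‖branchGain L σ j ω‖ ^ 2) * Θ < γ}

/-! ### The size threshold -/

/-- `1 - (p_MRC / (1 - exp (-γ/Γ))) ^ (1 / (N/2 - 1))`. -/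
def thresholdGap (N L : ℕ) (σ Θ γ : ℝ) : ℝ :=
  1 - (mrcOutage L σ Θ γ / (1 - Real.exp (-(γ / avgSNR σ Θ)))) ^ (1 / ((N : ℝ) / 2 - 1))

/-- The logarithm `ln (ϱ / (1 - (p_MRC / (1 - exp (-γ/Γ))) ^ (1 / (N/2 - 1))))`. -/
def thresholdLog (κ : ℝ) (N L : ℕ) (σ Θ γ : ℝ) : ℝ :=
  Real.log (rho κ / thresholdGap N L σ Θ γ)

/-- The autocorrelation level `μ* = √(1 - κ (γ/Γ) / ln (…))`. -/
def muStar (κ : ℝ) (N L : ℕ) (σ Θ γ : ℝ) : ℝ :=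
  Real.sqrt (1 - κ * (γ / avgSNR σ Θ) / thresholdLog κ N L σ Θ γ)

/-- The normalized size threshold `J₀⁻¹(μ*) / (2π)`. -/
def sizeThreshold (κ : ℝ) (N L : ℕ) (σ Θ γ : ℝ) : ℝ :=
  1 / (2 * Real.pi) * besselJ0Inv (muStar κ N L σ Θ γ)

end FluidAntenna

end

/-!
As `N → ∞` the outage probability of maximal ratio combining is a fixed positive number, so it
suffices that the outage probability of the fluid antenna system tends to `0`, uniformly in `W` at or
beyond the threshold.

Write `c = γ/Γ`, `l` for the logarithm in the threshold and `s = κ c / l`, so that `μ* = √(1 - s)`.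
Since `p_MRC < 1 - exp (-c)` strictly (`mrcOutage_lt`), `l` tends to infinity while `exp l = O(N)`
(`tendsto_thresholdLog`, `exists_exp_thresholdLog_le`), and `s` tends to `0`.

At the threshold only the last port is guaranteed a correlation of at most `μ*`, but a positive
fraction of the ports is almost as good. The bound `1 - t²/4 ≤ J₀(t)` gives `J₀⁻¹(μ*)² ≥ 2 s`, so the
ports `i ≥ r (N - 1)`, for a fixed `r < 1`, sit at arguments `t` with `t² ≥ 2 r² s`. There
`1 - J₀(t)² ≥ r³ s` once `s` is small (`exists_forall_le_one_sub_besselJ0_sq`): near `0` by Taylor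
expansion, and farther away because `|J₀|` is bounded away from `1`.

For such a port, an outage confines a Gaussian variable of variance `1/2` to a half-line `x < R` or
`-x < R` with `R² = c / (r³ s) = l / (κ r³)`; this replaces the Marcum function by a one-dimensional
tail, and the conditions are independent over the ports (`fasOutage_le`). The tail is at least
`exp (-(R + 1)²) / √π`, hence `p_FAS ≤ 2 exp (-C exp (l - (R + 1)²))` for a constant `C > 0`. Choosing
`r` with `κ r³ > 1`, possible because `κ > 1`, makes the exponent `l - (R + 1)²` tend to infinity.
-/

namespace FluidAntenna

/-! ### The Bessel function `J₀` -/

lemma continuous_besselJ0 : Continuous besselJ0 := by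
  unfold besselJ0
  refine continuous_const.mul ?_
  exact intervalIntegral.continuous_parametric_intervalIntegral_of_continuous' (by fun_prop) 0 Real.pi

lemma one_sub_sq_div_four_le_besselJ0 (x : ℝ) : 1 - x ^ 2 / 4 ≤ besselJ0 x := by
  have hπ := Real.pi_pos
  have h : ∫ θ in (0 : ℝ)..Real.pi, (1 - x ^ 2 / 2 * Real.sin θ ^ 2) ≤
      ∫ θ in (0 : ℝ)..Real.pi, Real.cos (x * Real.sin θ) := by
    refine intervalIntegral.integral_mono_on hπ.le (Continuous.intervalIntegrable (by fun_prop) _ _)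
      (Continuous.intervalIntegrable (by fun_prop) _ _) fun θ _ => ?_
    have := Real.one_sub_sq_div_two_le_cos (x := x * Real.sin θ)
    linarith [mul_pow x (Real.sin θ) 2]
  rw [intervalIntegral.integral_sub (by simp)
    (Continuous.intervalIntegrable (by fun_prop) _ _), intervalIntegral.integral_const_mul,
    integral_sin_sq] at h
  simp only [intervalIntegral.integral_const, Real.sin_pi, Real.sin_zero, smul_eq_mul] at h
  calc 1 - x ^ 2 / 4 = (1 / Real.pi) * (Real.pi * (1 - x ^ 2 / 4)) := by field_simp
    _ ≤ _ := by
      unfold besselJ0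
      gcongr
      linarith

lemma besselJ0_le_of_abs_le_one {x : ℝ} (hx : |x| ≤ 1) :
    besselJ0 x ≤ 1 - x ^ 2 / 4 + 5 / 96 * x ^ 4 := by
  have hπ := Real.pi_pos
  have h : ∫ θ in (0 : ℝ)..Real.pi, Real.cos (x * Real.sin θ) ≤
      ∫ θ in (0 : ℝ)..Real.pi, (1 + 5 / 96 * x ^ 4 - x ^ 2 / 2 * Real.sin θ ^ 2) := by
    refine intervalIntegral.integral_mono_on hπ.le (Continuous.intervalIntegrable (by fun_prop) _ _)
      (Continuous.intervalIntegrable (by fun_prop) _ _) fun θ _ => ?_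
    have hle : |x * Real.sin θ| ≤ |x| := by
      rw [abs_mul]
      exact mul_le_of_le_one_right (abs_nonneg x) (Real.abs_sin_le_one θ)
    have h1 := (abs_le.1 (Real.cos_bound (hle.trans hx))).2
    have h2 : |x * Real.sin θ| ^ 4 ≤ x ^ 4 := by
      calc _ ≤ |x| ^ 4 := by gcongr
        _ = x ^ 4 := by rw [← abs_pow, abs_of_nonneg (by positivity)]
    linarith [mul_pow x (Real.sin θ) 2]
  rw [intervalIntegral.integral_sub (by simp)
    (Continuous.intervalIntegrable (by fun_prop) _ _), intervalIntegral.integral_const_mul,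
    integral_sin_sq] at h
  simp only [intervalIntegral.integral_const, Real.sin_pi, Real.sin_zero, smul_eq_mul] at h
  calc besselJ0 x ≤ (1 / Real.pi) * (Real.pi * (1 - x ^ 2 / 4 + 5 / 96 * x ^ 4)) := by
        unfold besselJ0
        gcongr
        linarith
    _ = _ := by field_simp

/-- `J₀` stays away from `±1`. Since `1 ∓ cos (x sin θ) ≥ 0`, the integral over `[0, π]` of this
function dominates its integral over `[0, π/2]` against the weight `cos θ ≤ 1`, and the latter is
elementary through `u = sin θ`. -/
lemma one_sub_abs_sin_div_le {x : ℝ} (hx : 0 < x) :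
    1 / Real.pi * (1 - |Real.sin x| / x) ≤ 1 - |besselJ0 x| := by
  have hπ := Real.pi_pos
  have key : ∀ e : ℝ, |e| = 1 → 1 - e * Real.sin x / x ≤
      Real.pi - e * ∫ θ in (0 : ℝ)..Real.pi, Real.cos (x * Real.sin θ) := by
    intro e he
    have hnn : ∀ θ : ℝ, 0 ≤ 1 - e * Real.cos (x * Real.sin θ) := fun θ => by
      have h : |e * Real.cos (x * Real.sin θ)| ≤ 1 := by
        rw [abs_mul, he, one_mul]
        exact Real.abs_cos_le_one _
      linarith [(abs_le.1 h).2]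
    have hint : ∀ a b : ℝ, IntervalIntegrable (fun θ => 1 - e * Real.cos (x * Real.sin θ))
        volume a b := fun a b => Continuous.intervalIntegrable (by fun_prop) _ _
    have hprim : ∫ θ in (0 : ℝ)..(Real.pi / 2), (1 - e * Real.cos (x * Real.sin θ)) * Real.cos θ
        = 1 - e * Real.sin x / x := by
      rw [intervalIntegral.integral_eq_sub_of_hasDerivAt
        (f := fun θ => Real.sin θ - e * Real.sin (x * Real.sin θ) / x)]
      · simp
      · intro θ _
        have h1 := (((Real.hasDerivAt_sin θ).const_mul x).sin.const_mul e).div_const x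
        refine ((Real.hasDerivAt_sin θ).sub h1).congr_deriv ?_
        field_simp
      · exact Continuous.intervalIntegrable (by fun_prop) _ _
    have hweight : ∫ θ in (0 : ℝ)..(Real.pi / 2), (1 - e * Real.cos (x * Real.sin θ)) * Real.cos θ
        ≤ ∫ θ in (0 : ℝ)..(Real.pi / 2), (1 - e * Real.cos (x * Real.sin θ)) := by
      refine intervalIntegral.integral_mono_on (by positivity)
        (Continuous.intervalIntegrable (by fun_prop) _ _) (hint _ _) fun θ _ => ?_
      exact mul_le_of_le_one_right (hnn θ) (Real.cos_le_one θ)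
    have hrest : 0 ≤ ∫ θ in (Real.pi / 2)..Real.pi, (1 - e * Real.cos (x * Real.sin θ)) :=
      intervalIntegral.integral_nonneg (by linarith) fun θ _ => hnn θ
    have hsplit := intervalIntegral.integral_add_adjacent_intervals (hint 0 (Real.pi / 2))
      (hint (Real.pi / 2) Real.pi)
    have htot : ∫ θ in (0 : ℝ)..Real.pi, (1 - e * Real.cos (x * Real.sin θ)) =
        Real.pi - e * ∫ θ in (0 : ℝ)..Real.pi, Real.cos (x * Real.sin θ) := by
      rw [intervalIntegral.integral_sub (by simp)
        (Continuous.intervalIntegrable (by fun_prop) _ _), intervalIntegral.integral_const_mul]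
      simp
    linarith
  obtain ⟨e, he, heJ⟩ : ∃ e : ℝ, |e| = 1 ∧ |besselJ0 x| = e * besselJ0 x := by
    rcases abs_choice (besselJ0 x) with h | h
    · exact ⟨1, by simp, by simp [h]⟩
    · exact ⟨-1, by simp, by simp [h]⟩
  have hsin : e * Real.sin x / x ≤ |Real.sin x| / x := by
    gcongr
    calc _ ≤ |e * Real.sin x| := le_abs_self _
      _ = _ := by rw [abs_mul, he, one_mul]
  rw [heJ]
  calc 1 / Real.pi * (1 - |Real.sin x| / x)
      ≤ 1 / Real.pi * (Real.pi - e * ∫ θ in (0 : ℝ)..Real.pi, Real.cos (x * Real.sin θ)) := by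
        refine mul_le_mul_of_nonneg_left ?_ (by positivity)
        linarith [key e he]
    _ = 1 - e * besselJ0 x := by
        unfold besselJ0
        field_simp

lemma abs_besselJ0_le_of_two_le {t : ℝ} (ht : 2 ≤ t) : |besselJ0 t| ≤ 1 - 1 / (2 * Real.pi) := by
  have h := one_sub_abs_sin_div_le (x := t) (by linarith)
  have h2 : |Real.sin t| / t ≤ 1 / 2 := div_le_div₀ zero_le_one (Real.abs_sin_le_one t) two_pos ht
  have h3 : 1 / Real.pi * (1 / 2) ≤ 1 / Real.pi * (1 - |Real.sin t| / t) := by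
    gcongr
    linarith
  have h4 : 1 / (2 * Real.pi) = 1 / Real.pi * (1 / 2) := by
    field_simp
  linarith

/-- Away from the origin, `|J₀|` is uniformly less than `1`. -/
lemma exists_forall_abs_besselJ0_le {t₀ : ℝ} (ht₀ : 0 < t₀) :
    ∃ d : ℝ, 0 < d ∧ ∀ t, t₀ ≤ t → |besselJ0 t| ≤ 1 - d := by
  have hπ := Real.pi_pos
  by_cases h2 : 2 ≤ t₀
  · exact ⟨1 / (2 * Real.pi), by positivity, fun t ht => abs_besselJ0_le_of_two_le (h2.trans ht)⟩
  obtain ⟨m, ⟨hm1, hm2⟩, hmax⟩ := (isCompact_Icc (a := t₀) (b := 2)).exists_isMaxOn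
    (Set.nonempty_Icc.2 (by linarith)) (continuous_besselJ0.abs.continuousOn)
  have hm0 : 0 < m := ht₀.trans_le hm1
  have hlt : |besselJ0 m| < 1 := by
    have h := one_sub_abs_sin_div_le hm0
    have hs : |Real.sin m| / m < 1 := by
      rw [div_lt_one hm0]
      exact Real.abs_sin_lt_abs hm0.ne' |>.trans_eq (abs_of_pos hm0)
    have : 0 < 1 / Real.pi * (1 - |Real.sin m| / m) := by
      have : 0 < 1 - |Real.sin m| / m := by linarith
      positivity
    linarith
  refine ⟨min (1 - |besselJ0 m|) (1 / (2 * Real.pi)), lt_min (by linarith) (by positivity),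
    fun t ht => ?_⟩
  by_cases ht2 : t ≤ 2
  · have := hmax (Set.mem_Icc.2 ⟨ht, ht2⟩)
    simp only [Set.mem_ofPred_eq] at this
    linarith [min_le_left (1 - |besselJ0 m|) (1 / (2 * Real.pi))]
  · linarith [abs_besselJ0_le_of_two_le (not_le.1 ht2).le,
      min_le_right (1 - |besselJ0 m|) (1 / (2 * Real.pi))]

/-- The level set of `|J₀|` at a level close enough to `1` has a least element. -/
lemma isLeast_besselJ0Inv {μ : ℝ} (hμ : 1 - 1 / (2 * Real.pi) ≤ μ) :
    IsLeast (besselJ0LevelSet μ) (besselJ0Inv μ) := by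
  have hne : (besselJ0LevelSet μ).Nonempty :=
    ⟨2, zero_le_two, fun t ht => (abs_besselJ0_le_of_two_le ht).trans hμ⟩
  have hbdd : BddBelow (besselJ0LevelSet μ) := ⟨0, fun ε hε => hε.1⟩
  have hbeyond : ∀ t, besselJ0Inv μ < t → |besselJ0 t| ≤ μ := fun t ht => by
    obtain ⟨ε, hε, hεt⟩ := exists_lt_of_csInf_lt hne ht
    exact hε.2 t hεt.le
  refine ⟨⟨le_csInf hne fun ε hε => hε.1, fun t ht => ?_⟩, fun ε hε => csInf_le hbdd hε⟩
  have hcl : IsClosed {t : ℝ | |besselJ0 t| ≤ μ} :=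
    isClosed_le continuous_besselJ0.abs continuous_const
  have hsub : closure (Set.Ioi (besselJ0Inv μ)) ⊆ {t : ℝ | |besselJ0 t| ≤ μ} :=
    closure_minimal (fun t ht => hbeyond t ht) hcl
  rw [closure_Ioi] at hsub
  exact hsub ht

/-- Near the origin `1 - J₀(t)² ≥ r t²/2` for any factor `r < 1`. Together with the bound away from the
origin this gives, for small `s`, a lower bound on all of `t ≥ √(2 a s)`. -/
lemma exists_forall_le_one_sub_besselJ0_sq {a r : ℝ} (ha : 0 < a) (hr0 : 0 < r) (hr : r < 1) :
    ∃ s₀ : ℝ, 0 < s₀ ∧ ∀ s, s ≤ s₀ → ∀ t, 0 ≤ t → 2 * (a * s) ≤ t ^ 2 →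
      r * (a * s) ≤ 1 - besselJ0 t ^ 2 := by
  obtain ⟨d, hd, hfar⟩ := exists_forall_abs_besselJ0_le (sub_pos.2 hr)
  refine ⟨d / (r * a), by positivity, fun s hs t ht h => ?_⟩
  by_cases htr : t ≤ 1 - r
  · have hJ0 : 0 ≤ besselJ0 t := by nlinarith [one_sub_sq_div_four_le_besselJ0 t]
    have hJ := besselJ0_le_of_abs_le_one (x := t) (abs_le.2 ⟨by linarith, by linarith⟩)
    have hsq : besselJ0 t ^ 2 ≤ (1 - t ^ 2 / 4 + 5 / 96 * t ^ 4) ^ 2 := by gcongr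
    have hw : t ^ 2 ≤ 1 - r := by nlinarith
    have h4 : t ^ 4 = (t ^ 2) ^ 2 := by ring
    have hw0 := sq_nonneg t
    rw [h4] at hsq
    generalize t ^ 2 = w at *
    have h1 : w / 2 * r ≤ w / 4 * (1 - 5 / 24 * w) * (2 - w / 4) := by
      have : r ≤ (1 - 5 / 24 * w) * (1 - w / 8) := by nlinarith
      nlinarith [mul_le_mul_of_nonneg_left this hw0]
    have h2 : 0 ≤ w / 4 * (1 - 5 / 24 * w) * (5 / 96 * w ^ 2) := by
      have : 0 ≤ 1 - 5 / 24 * w := by linarith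
      positivity
    have h3 : r * (a * s) ≤ w / 2 * r := by nlinarith
    nlinarith
  · have hJ := hfar t (not_le.1 htr).le
    have h1 : r * (a * s) ≤ d := by
      rw [le_div_iff₀ (by positivity)] at hs
      linarith
    have h2 : besselJ0 t ^ 2 ≤ |besselJ0 t| := by
      rw [← sq_abs]
      nlinarith [abs_nonneg (besselJ0 t)]
    linarith

/-! ### Gaussian pairs -/

instance : IsProbabilityMeasure pairLaw := by
  unfold pairLaw
  infer_instance

instance (n : ℕ) : IsProbabilityMeasure (pairsLaw n) := by
  unfold pairsLaw
  infer_instance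

instance : pairLaw.IsOpenPosMeasure := by
  have h : (gaussianReal 0 (1 / 2 : ℝ≥0)).IsOpenPosMeasure :=
    (gaussianReal_absolutelyContinuous' 0 (by norm_num)).isOpenPosMeasure
  unfold pairLaw
  infer_instance

instance (n : ℕ) : (pairsLaw n).IsOpenPosMeasure := by
  unfold pairsLaw
  infer_instance

lemma gaussianPDFReal_zero_half (x : ℝ) :
    gaussianPDFReal 0 (1 / 2 : ℝ≥0) x = (Real.sqrt Real.pi)⁻¹ * Real.exp (-x ^ 2) := by
  unfold gaussianPDFReal
  congr 2
  · push_cast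
    congr 1
    ring
  · push_cast
    ring

/-- A lower bound for the Gaussian tail, from the mass of `[R, R + 1]`. -/
lemma exp_le_gaussianReal_Ici {R : ℝ} (hR : 0 ≤ R) :
    (Real.sqrt Real.pi)⁻¹ * Real.exp (-(R + 1) ^ 2) ≤
      (gaussianReal 0 (1 / 2 : ℝ≥0)).real (Set.Ici R) := by
  have hv : (1 / 2 : ℝ≥0) ≠ 0 := by norm_num
  calc (Real.sqrt Real.pi)⁻¹ * Real.exp (-(R + 1) ^ 2)
      = ∫ _ in Set.Icc R (R + 1), (Real.sqrt Real.pi)⁻¹ * Real.exp (-(R + 1) ^ 2) := by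
        simp
    _ ≤ ∫ x in Set.Icc R (R + 1), gaussianPDFReal 0 (1 / 2 : ℝ≥0) x := by
        refine setIntegral_mono_on (integrableOn_const (by simp))
          (integrable_gaussianPDFReal _ _).integrableOn
          measurableSet_Icc fun x hx => ?_
        rw [gaussianPDFReal_zero_half]
        have hx0 : 0 ≤ x := hR.trans hx.1
        have hx1 := hx.2
        gcongr
    _ = (gaussianReal 0 (1 / 2 : ℝ≥0)).real (Set.Icc R (R + 1)) := by
        rw [Measure.real, gaussianReal_apply_eq_integral _ hv, ENNReal.toReal_ofReal]
        exact integral_nonneg fun x => gaussianPDFReal_nonneg _ _ _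
    _ ≤ _ := measureReal_mono Set.Icc_subset_Ici_self

lemma pairLaw_real_fst_lt (R e : ℝ) (he : e = 1 ∨ e = -1) :
    pairLaw.real {z | e * z.1 < R} = 1 - (gaussianReal 0 (1 / 2 : ℝ≥0)).real (Set.Ici R) := by
  have hIio : (gaussianReal 0 (1 / 2 : ℝ≥0)).real (Set.Iio R) =
      1 - (gaussianReal 0 (1 / 2 : ℝ≥0)).real (Set.Ici R) := by
    rw [← Set.compl_Ici, probReal_compl_eq_one_sub measurableSet_Ici]
  have hset : {z : ℝ × ℝ | e * z.1 < R} = {x : ℝ | e * x < R} ×ˢ Set.univ := by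
    ext z
    simp
  rw [hset, pairLaw, measureReal_prod_prod, probReal_univ, mul_one, ← hIio]
  rcases he with rfl | rfl
  · simp only [one_mul]
    rfl
  · conv_rhs => rw [show (0 : ℝ) = -0 by simp, ← gaussianReal_map_neg,
      map_measureReal_apply measurable_neg measurableSet_Iio]
    congr 1
    ext x
    simp [neg_lt]

/-! ### Outage of the fluid antenna system -/

/-- Ports whose decorrelation `1 - μ²` is large force a small outage probability. On the outage
event the real part of the gain of such a port confines `± x_i` to a half-line, the sign depending
on the signs of the correlation and of the shared variable `x₀` only; once the sign of `x₀` is fixed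
these conditions are independent. -/
lemma fasOutage_le {N : ℕ} {W σ Θ γ R : ℝ} (hσ : 0 < σ) (hΘ : 0 < Θ) (hR : 0 ≤ R)
    (I : Finset (Fin N)) (hI : ∀ i ∈ I, (i : ℕ) ≠ 0 ∧ 0 < 1 - portCorr N W i ^ 2 ∧
      γ / avgSNR σ Θ ≤ R ^ 2 * (1 - portCorr N W i ^ 2)) :
    fasOutage N W σ Θ γ ≤
      2 * (1 - (gaussianReal 0 (1 / 2 : ℝ≥0)).real (Set.Ici R)) ^ I.card := by
  classical
  set T := (gaussianReal 0 (1 / 2 : ℝ≥0)).real (Set.Ici R) with hT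
  let sg : Fin N → ℝ := fun i => if 0 ≤ portCorr N W i then 1 else -1
  let S : ℝ → Fin (N + 1) → Set (ℝ × ℝ) := fun e =>
    Fin.cases Set.univ fun i => if i ∈ I then {z | e * sg i * z.1 < R} else Set.univ
  have hmeas : ∀ e : ℝ, e = 1 ∨ e = -1 →
      (pairsLaw (N + 1)).real (Set.univ.pi (S e)) = (1 - T) ^ I.card := by
    intro e he
    rw [pairsLaw, Measure.real, Measure.pi_pi, ENNReal.toReal_prod, Fin.prod_univ_succ]
    have h0 : (pairLaw (S e 0)).toReal = 1 := by simp [S]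
    have hi : ∀ i : Fin N, (pairLaw (S e i.succ)).toReal = if i ∈ I then 1 - T else 1 := by
      intro i
      simp only [S, Fin.cases_succ]
      split_ifs with h
      · refine pairLaw_real_fst_lt R (e * sg i) ?_
        simp only [sg]
        rcases he with rfl | rfl <;> split_ifs <;> simp
      · simp
    rw [h0, Finset.prod_congr rfl fun i _ => hi i, one_mul, Finset.prod_ite_mem,
      Finset.univ_inter, Finset.prod_const]
  have hsub : {ω | fasEnvelope N W σ ω ^ 2 * Θ < γ} ⊆
      Set.univ.pi (S 1) ∪ Set.univ.pi (S (-1)) := by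
    intro ω hω
    have hhalf : ∀ i ∈ I, |Real.sqrt (1 - portCorr N W i ^ 2) * (ω i.succ).1 +
        portCorr N W i * (ω 0).1| < R * Real.sqrt (1 - portCorr N W i ^ 2) := by
      intro i hi
      obtain ⟨hi0, hs, hle⟩ := hI i hi
      have h1 : ‖portGain N W σ i ω‖ ≤ fasEnvelope N W σ ω :=
        le_ciSup (f := fun i => ‖portGain N W σ i ω‖) (Set.finite_range _).bddAbove i
      have h2 : |σ * (Real.sqrt (1 - portCorr N W i ^ 2) * (ω i.succ).1 +
          portCorr N W i * (ω 0).1)| ≤ fasEnvelope N W σ ω := by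
        refine le_trans ?_ h1
        have := Complex.abs_re_le_norm (portGain N W σ i ω)
        simpa only [portGain, if_neg hi0] using this
      refine abs_lt_of_sq_lt_sq ?_ (by positivity)
      rw [mul_pow, Real.sq_sqrt hs.le]
      refine lt_of_lt_of_le ?_ hle
      rw [lt_div_iff₀ (by unfold avgSNR; positivity)]
      refine lt_of_le_of_lt ?_ hω
      calc _ = |σ * (Real.sqrt (1 - portCorr N W i ^ 2) * (ω i.succ).1 +
          portCorr N W i * (ω 0).1)| ^ 2 * Θ := by rw [sq_abs, avgSNR]; ring
        _ ≤ _ := by gcongr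
    have hmem : ∀ e : ℝ, (e = 1 ∨ e = -1) → 0 ≤ e * (ω 0).1 → ω ∈ Set.univ.pi (S e) := by
      intro e he hx j _
      refine Fin.cases (by simp [S]) (fun i => ?_) j
      simp only [S, Fin.cases_succ]
      split_ifs with hi
      · have hlt := abs_lt.1 (hhalf i hi)
        have hs : 0 < Real.sqrt (1 - portCorr N W i ^ 2) := Real.sqrt_pos.2 (hI i hi).2.1
        have hprod : 0 ≤ e * sg i * (portCorr N W i * (ω 0).1) := by
          have : 0 ≤ sg i * portCorr N W i := by
            simp only [sg]
            split_ifs <;> linarith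
          calc 0 ≤ (sg i * portCorr N W i) * (e * (ω 0).1) := mul_nonneg this hx
            _ = _ := by ring
        show e * sg i * (ω i.succ).1 < R
        have hes : e * sg i = 1 ∨ e * sg i = -1 := by
          simp only [sg]
          rcases he with rfl | rfl <;> split_ifs <;> simp
        refine lt_of_mul_lt_mul_right ?_ hs.le
        rcases hes with h | h <;> rw [h] at hprod ⊢ <;> nlinarith [hlt.1, hlt.2]
      · trivial
    rcases le_total 0 (ω 0).1 with hx | hx
    · exact Or.inl (hmem 1 (Or.inl rfl) (by linarith))
    · exact Or.inr (hmem (-1) (Or.inr rfl) (by linarith))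
  calc fasOutage N W σ Θ γ
      ≤ (pairsLaw (N + 1)).real (Set.univ.pi (S 1) ∪ Set.univ.pi (S (-1))) :=
        measureReal_mono hsub
    _ ≤ _ := measureReal_union_le _ _
    _ = 2 * (1 - T) ^ I.card := by
        rw [hmeas 1 (Or.inl rfl), hmeas (-1) (Or.inr rfl)]
        ring

/-! ### Outage of maximal ratio combining -/

/-- The squared modulus of a standard complex Gaussian variable is exponentially distributed. -/
lemma pairLaw_real_disc {c : ℝ} (hc : 0 < c) :
    pairLaw.real {z | z.1 ^ 2 + z.2 ^ 2 < c} = 1 - Real.exp (-c) := by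
  have hπ := Real.pi_pos
  have hmeas : MeasurableSet {z : ℝ × ℝ | z.1 ^ 2 + z.2 ^ 2 < c} :=
    measurableSet_lt (by fun_prop) (by fun_prop)
  let f : ℝ × ℝ → ℝ := fun z => Real.pi⁻¹ * Real.exp (-(z.1 ^ 2 + z.2 ^ 2))
  have hdens : pairLaw = (volume : Measure (ℝ × ℝ)).withDensity fun z => ENNReal.ofReal (f z) := by
    rw [pairLaw, gaussianReal_of_var_ne_zero _ (by norm_num),
      prod_withDensity (by fun_prop) (by fun_prop), ← Measure.volume_eq_prod]
    congr 1
    ext z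
    rw [gaussianPDF, gaussianPDF, ← ENNReal.ofReal_mul (gaussianPDFReal_nonneg _ _ _),
      gaussianPDFReal_zero_half, gaussianPDFReal_zero_half]
    congr 1
    calc _ = (Real.sqrt Real.pi * Real.sqrt Real.pi)⁻¹ *
          (Real.exp (-z.1 ^ 2) * Real.exp (-z.2 ^ 2)) := by
          rw [mul_inv]
          ring
      _ = _ := by
          rw [Real.mul_self_sqrt hπ.le, ← Real.exp_add, ← neg_add]
  calc pairLaw.real {z | z.1 ^ 2 + z.2 ^ 2 < c}
      = ∫ z in {z : ℝ × ℝ | z.1 ^ 2 + z.2 ^ 2 < c}, f z := by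
        rw [integral_eq_lintegral_of_nonneg_ae (Filter.Eventually.of_forall fun z => by positivity)
          (by fun_prop), Measure.real, hdens, withDensity_apply _ hmeas]
    _ = ∫ z, {z : ℝ × ℝ | z.1 ^ 2 + z.2 ^ 2 < c}.indicator f z := (integral_indicator hmeas).symm
    _ = ∫ p in Set.Ioi (0 : ℝ) ×ˢ Set.Ioo (-Real.pi) Real.pi,
          (Set.Iio (Real.sqrt c)).indicator (fun r => Real.pi⁻¹ * (r * Real.exp (-r ^ 2))) p.1 *
            (1 : ℝ) := by
        rw [← integral_comp_polarCoord_symm]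
        refine setIntegral_congr_fun (measurableSet_Ioi.prod measurableSet_Ioo) fun p hp => ?_
        have hp0 : 0 < p.1 := hp.1
        have hsq : (p.1 * Real.cos p.2) ^ 2 + (p.1 * Real.sin p.2) ^ 2 = p.1 ^ 2 := by
          rw [mul_pow, mul_pow, ← mul_add, Real.cos_sq_add_sin_sq, mul_one]
        have hiff : p.1 ^ 2 < c ↔ p.1 < Real.sqrt c := (Real.lt_sqrt hp0.le).symm
        simp only [polarCoord_symm_apply, Set.indicator_apply, Set.mem_ofPred_eq, hsq, hiff,
          Set.mem_Iio, smul_eq_mul, f]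
        split_ifs <;> ring
    _ = (∫ r in Set.Ioi (0 : ℝ), (Set.Iio (Real.sqrt c)).indicator
          (fun r => Real.pi⁻¹ * (r * Real.exp (-r ^ 2))) r) * (2 * Real.pi) := by
        rw [Measure.volume_eq_prod, setIntegral_prod_mul _ fun _ => (1 : ℝ)]
        congr 1
        simp [hπ.le]
        ring
    _ = (∫ r in (0 : ℝ)..Real.sqrt c, Real.pi⁻¹ * (r * Real.exp (-r ^ 2))) * (2 * Real.pi) := by
        rw [setIntegral_indicator measurableSet_Iio, Set.Ioi_inter_Iio,
          intervalIntegral.integral_of_le (Real.sqrt_nonneg c), integral_Ioc_eq_integral_Ioo]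
    _ = 1 - Real.exp (-c) := by
        rw [intervalIntegral.integral_eq_sub_of_hasDerivAt
          (f := fun r => -(2 * Real.pi)⁻¹ * Real.exp (-r ^ 2))]
        · rw [Real.sq_sqrt hc.le]
          field_simp
          simp
          ring
        · intro r _
          refine (((hasDerivAt_pow 2 r).neg.exp).const_mul (-(2 * Real.pi)⁻¹)).congr_deriv ?_
          field_simp
          simp
          ring
        · exact Continuous.intervalIntegrable (by fun_prop) _ _

section MRC

variable {L : ℕ} {σ Θ γ : ℝ}

lemma mrcOutage_eq (hσ : 0 < σ) (hΘ : 0 < Θ) :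
    mrcOutage L σ Θ γ = (pairsLaw L).real
      {ω | ∑ j, ((ω j).1 ^ 2 + (ω j).2 ^ 2) < γ / avgSNR σ Θ} := by
  unfold mrcOutage
  congr 1
  ext ω
  rw [Set.mem_ofPred_eq, Set.mem_ofPred_eq, lt_div_iff₀ (by unfold avgSNR; positivity),
    Finset.sum_mul, Finset.sum_mul]
  refine iff_of_eq (congrArg (· < γ) (Finset.sum_congr rfl fun j _ => ?_))
  rw [← Complex.normSq_eq_norm_sq, Complex.normSq_apply, branchGain, avgSNR]
  ring

lemma mrcOutage_pos (hσ : 0 < σ) (hΘ : 0 < Θ) (hγ : 0 < γ) : 0 < mrcOutage L σ Θ γ := by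
  have hc : 0 < γ / avgSNR σ Θ := by unfold avgSNR; positivity
  rw [mrcOutage_eq hσ hΘ]
  refine ENNReal.toReal_pos (IsOpen.measure_pos _ ?_ ⟨fun _ => 0, by simpa using hc⟩).ne'
    (measure_ne_top _ _)
  exact isOpen_lt (by fun_prop) continuous_const

lemma mrcOutage_lt (hσ : 0 < σ) (hΘ : 0 < Θ) (hγ : 0 < γ) (hL : 2 ≤ L) :
    mrcOutage L σ Θ γ < 1 - Real.exp (-(γ / avgSNR σ Θ)) := by
  have hc : 0 < γ / avgSNR σ Θ := by unfold avgSNR; positivity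
  rw [mrcOutage_eq hσ hΘ]
  set c := γ / avgSNR σ Θ
  let j₀ : Fin L := ⟨0, by omega⟩
  let j₁ : Fin L := ⟨1, by omega⟩
  have hne : j₀ ≠ j₁ := by simp [j₀, j₁]
  let A : Set (Fin L → ℝ × ℝ) := {ω | ∑ j, ((ω j).1 ^ 2 + (ω j).2 ^ 2) < c}
  let B : Set (Fin L → ℝ × ℝ) := {ω | (ω j₀).1 ^ 2 + (ω j₀).2 ^ 2 < c} ∩
    {ω | c < (ω j₁).1 ^ 2 + (ω j₁).2 ^ 2}
  have hBopen : IsOpen B :=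
    (isOpen_lt (by fun_prop) continuous_const).inter (isOpen_lt continuous_const (by fun_prop))
  have hB : 0 < (pairsLaw L).real B := by
    refine ENNReal.toReal_pos (IsOpen.measure_pos _ hBopen
      ⟨fun j => if j = j₀ then 0 else (Real.sqrt (c + 1), 0), ?_, ?_⟩).ne' (measure_ne_top _ _)
    · simpa using hc
    · simp [hne.symm, Real.sq_sqrt (add_nonneg hc.le zero_le_one)]
  have hle : ∀ ω : Fin L → ℝ × ℝ, ∀ j,
      (ω j).1 ^ 2 + (ω j).2 ^ 2 ≤ ∑ j, ((ω j).1 ^ 2 + (ω j).2 ^ 2) := fun ω j =>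
    Finset.single_le_sum (f := fun j => (ω j).1 ^ 2 + (ω j).2 ^ 2)
      (fun i _ => by positivity) (Finset.mem_univ j)
  have hdisj : Disjoint A B := Set.disjoint_left.2 fun ω hA hB =>
    absurd ((hle ω j₁).trans_lt hA) (not_lt.2 (le_of_lt hB.2))
  have hsub : A ∪ B ⊆ Function.eval j₀ ⁻¹' {z : ℝ × ℝ | z.1 ^ 2 + z.2 ^ 2 < c} :=
    Set.union_subset (fun ω hA => (hle ω j₀).trans_lt hA) fun ω hB => hB.1
  calc (pairsLaw L).real A < (pairsLaw L).real A + (pairsLaw L).real B := by linarith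
    _ = (pairsLaw L).real (A ∪ B) := (measureReal_union hdisj hBopen.measurableSet).symm
    _ ≤ _ := measureReal_mono hsub
    _ = 1 - Real.exp (-c) := by
        rw [← pairLaw_real_disc hc, pairsLaw]
        exact (measurePreserving_eval (fun _ : Fin L => pairLaw) j₀).measureReal_preimage
          (measurableSet_lt (by fun_prop) (by fun_prop)).nullMeasurableSet

end MRC

/-! ### Asymptotics of the threshold -/

open Filter Topology

lemma rho_pos {κ : ℝ} (hκ : 1 < κ) : 0 < rho κ := by
  have hπ := Real.pi_pos
  have h : 0 < κ - 1 := by linarith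
  unfold rho
  positivity

section Threshold

variable {κ σ Θ γ : ℝ} {L : ℕ}

lemma exists_thresholdGap_eq (hσ : 0 < σ) (hΘ : 0 < Θ) (hγ : 0 < γ) (hL : 2 ≤ L) :
    ∃ a : ℝ, 0 < a ∧ ∀ N : ℕ, thresholdGap N L σ Θ γ = 1 - Real.exp (-(a / ((N : ℝ) / 2 - 1))) := by
  have hp := mrcOutage_pos (L := L) hσ hΘ hγ
  have hlt := mrcOutage_lt hσ hΘ hγ hL
  set q := mrcOutage L σ Θ γ / (1 - Real.exp (-(γ / avgSNR σ Θ))) with hq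
  have hq0 : 0 < q := div_pos hp (hp.trans hlt)
  have hq1 : q < 1 := (div_lt_one (hp.trans hlt)).2 hlt
  refine ⟨-Real.log q, neg_pos.2 (Real.log_neg hq0 hq1), fun N => ?_⟩
  rw [thresholdGap, ← hq, Real.rpow_def_of_pos hq0]
  congr 2
  ring

lemma thresholdGap_pos (hσ : 0 < σ) (hΘ : 0 < Θ) (hγ : 0 < γ) (hL : 2 ≤ L) {N : ℕ} (hN : 2 < N) :
    0 < thresholdGap N L σ Θ γ := by
  obtain ⟨a, ha, h⟩ := exists_thresholdGap_eq (L := L) hσ hΘ hγ hL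
  have hN' : (2 : ℝ) < N := by exact_mod_cast hN
  have : 0 < a / ((N : ℝ) / 2 - 1) := div_pos ha (by linarith)
  rw [h, sub_pos, Real.exp_lt_one_iff]
  linarith

lemma tendsto_thresholdGap (hσ : 0 < σ) (hΘ : 0 < Θ) (hγ : 0 < γ) (hL : 2 ≤ L) :
    Tendsto (fun N : ℕ => thresholdGap N L σ Θ γ) atTop (𝓝 0) := by
  obtain ⟨a, -, h⟩ := exists_thresholdGap_eq (L := L) hσ hΘ hγ hL
  simp_rw [h]
  have h1 : Tendsto (fun N : ℕ => (N : ℝ) / 2 - 1) atTop atTop :=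
    tendsto_atTop_add_const_right _ _ (tendsto_natCast_atTop_atTop.atTop_div_const two_pos)
  have h2 := (Real.continuous_exp.tendsto _).comp (h1.const_div_atTop a).neg
  simpa using h2.const_sub 1

lemma tendsto_thresholdLog (hκ : 1 < κ) (hσ : 0 < σ) (hΘ : 0 < Θ) (hγ : 0 < γ) (hL : 2 ≤ L) :
    Tendsto (fun N : ℕ => thresholdLog κ N L σ Θ γ) atTop atTop := by
  have h : Tendsto (fun N : ℕ => thresholdGap N L σ Θ γ) atTop (𝓝[>] 0) :=
    tendsto_nhdsWithin_iff.2 ⟨tendsto_thresholdGap hσ hΘ hγ hL,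
      (eventually_gt_atTop 2).mono fun N hN => thresholdGap_pos hσ hΘ hγ hL hN⟩
  refine Real.tendsto_log_atTop.comp ?_
  simp_rw [div_eq_mul_inv]
  exact (tendsto_inv_nhdsGT_zero.comp h).const_mul_atTop (rho_pos hκ)

/-- The number of ports grows at least like `ϱ / (1 - q ^ (1 / (N / 2 - 1)))`, the argument of the
logarithm in the threshold. -/
lemma exists_exp_thresholdLog_le (hκ : 1 < κ) (hσ : 0 < σ) (hΘ : 0 < Θ) (hγ : 0 < γ) (hL : 2 ≤ L) :
    ∃ K : ℝ, 0 < K ∧ ∀ N : ℕ, 2 < N → Real.exp (thresholdLog κ N L σ Θ γ) ≤ K * N := by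
  obtain ⟨a, ha, h⟩ := exists_thresholdGap_eq (L := L) hσ hΘ hγ hL
  have hρ := rho_pos hκ
  refine ⟨rho κ * ((1 + a) / a), by positivity, fun N hN => ?_⟩
  have hδ := thresholdGap_pos hσ hΘ hγ hL hN
  have hN' : (2 : ℝ) < N := by exact_mod_cast hN
  rw [thresholdLog, Real.exp_log (by positivity), div_eq_mul_inv, mul_assoc]
  refine mul_le_mul_of_nonneg_left ?_ hρ.le
  have hν : 0 < (N : ℝ) / 2 - 1 := by linarith
  have hle : a / ((N : ℝ) / 2 - 1 + a) ≤ thresholdGap N L σ Θ γ := by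
    have h1 : Real.exp (-(a / ((N : ℝ) / 2 - 1))) ≤ (a / ((N : ℝ) / 2 - 1) + 1)⁻¹ := by
      rw [Real.exp_neg]
      gcongr
      exact Real.add_one_le_exp _
    rw [h]
    generalize (N : ℝ) / 2 - 1 = ν at *
    have h2 : a / (ν + a) = 1 - (a / ν + 1)⁻¹ := by
      field_simp
      ring
    linarith
  calc (thresholdGap N L σ Θ γ)⁻¹ ≤ (a / ((N : ℝ) / 2 - 1 + a))⁻¹ := by gcongr
    _ = ((N : ℝ) / 2 - 1 + a) / a := inv_div _ _
    _ ≤ ((1 + a) * N) / a := by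
        gcongr
        nlinarith
    _ = (1 + a) / a * N := by ring

end Threshold

lemma tendsto_sub_sqrt_div_add_one_sq {b : ℝ} (hb : 1 < b) :
    Tendsto (fun l : ℝ => l - (Real.sqrt (l / b) + 1) ^ 2) atTop atTop := by
  have hb1 : 0 < b - 1 := by linarith
  have hlin : Tendsto (fun l : ℝ => (b - 1) / (2 * b) * l + -(1 + 2 / (b - 1))) atTop atTop :=
    tendsto_atTop_add_const_right _ _ (tendsto_id.const_mul_atTop (by positivity))
  refine tendsto_atTop_mono' _ ((eventually_ge_atTop 0).mono fun l hl => ?_) hlin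
  beta_reduce
  have hsq : Real.sqrt (l / b) ^ 2 = l / b := Real.sq_sqrt (by positivity)
  generalize Real.sqrt (l / b) = y at *
  obtain rfl : l = b * y ^ 2 := by
    rw [hsq]
    field_simp
  -- Young's inequality `2 y ≤ η y² + 1 / η` with `η = (b - 1) / 2`
  have hyoung : 2 * y ≤ (b - 1) / 2 * y ^ 2 + 2 / (b - 1) := by
    have h := sq_nonneg ((b - 1) * y - 2)
    have : (b - 1) / 2 * y ^ 2 + 2 / (b - 1) - 2 * y = ((b - 1) * y - 2) ^ 2 / (2 * (b - 1)) := by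
      field_simp
      ring
    have : 0 ≤ ((b - 1) * y - 2) ^ 2 / (2 * (b - 1)) := by positivity
    linarith
  have : (b - 1) / (2 * b) * (b * y ^ 2) = (b - 1) / 2 * y ^ 2 := by field_simp
  linarith

lemma exists_lt_one_and_one_lt_mul_pow {κ : ℝ} (hκ : 1 < κ) :
    ∃ r : ℝ, 0 < r ∧ r < 1 ∧ 1 < κ * r ^ 3 := by
  have h : Tendsto (fun r : ℝ => κ * r ^ 3) (𝓝[<] 1) (𝓝 (κ * 1 ^ 3)) :=
    (Continuous.tendsto (by fun_prop) 1).mono_left nhdsWithin_le_nhds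
  obtain ⟨r, hr, hr0, hr1⟩ := ((h.eventually_const_lt (by simpa using hκ)).and
    (Ioo_mem_nhdsLT (zero_lt_one (α := ℝ)))).exists
  exact ⟨r, hr0, hr1, hr⟩

/-- The inverse of `J₀` at the level `√(1 - s)` is at least `√(2 s)`, because `J₀(t) ≥ 1 - t²/4`. -/
lemma two_mul_le_besselJ0Inv_sq {s : ℝ} (hs : s ≤ 1)
    (h : IsLeast (besselJ0LevelSet (Real.sqrt (1 - s))) (besselJ0Inv (Real.sqrt (1 - s)))) :
    2 * s ≤ besselJ0Inv (Real.sqrt (1 - s)) ^ 2 := by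
  have h1 := (le_abs_self _).trans (h.1.2 _ le_rfl)
  have h2 := one_sub_sq_div_four_le_besselJ0 (besselJ0Inv (Real.sqrt (1 - s)))
  have h3 : Real.sqrt (1 - s) ≤ 1 - s / 2 := Real.sqrt_le_iff.2
    ⟨by linarith, by nlinarith [sq_nonneg s]⟩
  linarith

/-- The ports `i ≥ r (N - 1)`: their number is at least `(1 - r) (N - 1)`. -/
lemma exists_finset_ports {N : ℕ} (hN : 2 < N) {r : ℝ} (hr0 : 0 < r) (hr1 : r < 1) :
    ∃ I : Finset (Fin N), (1 - r) * ((N : ℝ) - 1) ≤ I.card ∧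
      ∀ i ∈ I, r * ((N : ℝ) - 1) ≤ (i : ℝ) := by
  have hN' : (2 : ℝ) < N := by exact_mod_cast hN
  have hceil := Nat.ceil_lt_add_one (a := r * ((N : ℝ) - 1)) (by nlinarith)
  have hm : ⌈r * ((N : ℝ) - 1)⌉₊ < N := by
    have : ((⌈r * ((N : ℝ) - 1)⌉₊ : ℕ) : ℝ) < N := by nlinarith
    exact_mod_cast this
  refine ⟨Finset.Ici ⟨_, hm⟩, ?_, fun i hi => ?_⟩
  · rw [Fin.card_Ici, Nat.cast_sub hm.le]
    linarith
  · have h : ⌈r * ((N : ℝ) - 1)⌉₊ ≤ (i : ℕ) := Fin.le_def.1 (Finset.mem_Ici.1 hi)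
    exact (Nat.le_ceil _).trans (by exact_mod_cast h)

end FluidAntenna

/-! ### The comparison -/

open Filter FluidAntenna in
theorem theorem9 (σ Θ γ κ : ℝ) (L : ℕ) (hσ : 0 < σ) (hΘ : 0 < Θ) (hγ : 0 < γ)
    (hκ : 1 < κ) (hL : 2 ≤ L) :
    ∃ N₀ : ℕ, ∀ N : ℕ, N₀ ≤ N →
      -- the threshold is well defined (no degenerate power, logarithm, root or inverse)
      (2 < N ∧ 0 < FluidAntenna.thresholdGap N L σ Θ γ ∧
        κ * (γ / FluidAntenna.avgSNR σ Θ) < FluidAntenna.thresholdLog κ N L σ Θ γ ∧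
        IsLeast (FluidAntenna.besselJ0LevelSet (FluidAntenna.muStar κ N L σ Θ γ))
          (FluidAntenna.besselJ0Inv (FluidAntenna.muStar κ N L σ Θ γ))) ∧
      -- and at or beyond it the fluid antenna system outperforms maximal ratio combining
      ∀ W : ℝ, FluidAntenna.sizeThreshold κ N L σ Θ γ ≤ W →
        FluidAntenna.fasOutage N W σ Θ γ < FluidAntenna.mrcOutage L σ Θ γ := by
  have hπ := Real.pi_pos
  have hc : 0 < γ / avgSNR σ Θ := by unfold avgSNR; positivity
  have hp := mrcOutage_pos (L := L) hσ hΘ hγ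
  obtain ⟨r, hr0, hr1, hκr⟩ := exists_lt_one_and_one_lt_mul_pow hκ
  obtain ⟨s₀, hs₀, hbessel⟩ := exists_forall_le_one_sub_besselJ0_sq (a := r ^ 2) (by positivity)
    hr0 hr1
  obtain ⟨K, hK, hexp⟩ := exists_exp_thresholdLog_le (L := L) hκ hσ hΘ hγ hL
  have hlog := tendsto_thresholdLog (L := L) hκ hσ hΘ hγ hL
  set c := γ / avgSNR σ Θ with hcdef
  set p := mrcOutage L σ Θ γ
  -- `C` collects the constants of the tail bound, of the proportion of ports `i ≥ r (N - 1)`, and of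
  -- `exp l ≤ K N`
  let C : ℝ := (Real.sqrt Real.pi)⁻¹ * ((1 - r) / (2 * K))
  have hC : 0 < C := by
    have : 0 < 1 - r := by linarith
    positivity
  have hbig := (((Real.tendsto_exp_atTop.comp ((tendsto_sub_sqrt_div_add_one_sq hκr).comp
    hlog)).const_mul_atTop hC).eventually_gt_atTop (Real.log (2 / p)))
  have hsmall := (hlog.const_div_atTop (κ * c)).eventually_lt_const
    (lt_min hs₀ (show (0 : ℝ) < 1 / (2 * Real.pi) by positivity))
  obtain ⟨N₀, hN₀⟩ := eventually_atTop.1 (((hbig.and hsmall).and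
    (hlog.eventually_gt_atTop (κ * c))).and (eventually_gt_atTop 2))
  refine ⟨N₀, fun N hN => ?_⟩
  obtain ⟨⟨⟨hbigN, hsmallN⟩, hlogN⟩, hN2⟩ := hN₀ N hN
  simp only [Function.comp_apply] at hbigN
  have hμ : muStar κ N L σ Θ γ = Real.sqrt (1 - κ * c / thresholdLog κ N L σ Θ γ) := rfl
  have hexpN := hexp N hN2
  have hl0 : 0 < thresholdLog κ N L σ Θ γ := lt_trans (by positivity) hlogN
  have hthr : sizeThreshold κ N L σ Θ γ =
    1 / (2 * Real.pi) * besselJ0Inv (muStar κ N L σ Θ γ) := rfl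
  have hgap := thresholdGap_pos (L := L) hσ hΘ hγ hL hN2
  generalize sizeThreshold κ N L σ Θ γ = w at *
  generalize muStar κ N L σ Θ γ = μ at *
  generalize thresholdLog κ N L σ Θ γ = l at *
  subst hμ
  set s := κ * c / l with hsdef
  have hs0 : 0 < s := by positivity
  have hs1 : s ≤ 1 := ((div_lt_one hl0).2 hlogN).le
  have hleast : IsLeast (besselJ0LevelSet (Real.sqrt (1 - s))) (besselJ0Inv (Real.sqrt (1 - s))) := by
    refine isLeast_besselJ0Inv (Real.le_sqrt_of_sq_le ?_)
    have h1 : 1 / (2 * Real.pi) ≤ 1 := by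
      rw [div_le_one (by positivity)]
      linarith [Real.pi_gt_three]
    have h2 : 0 < 1 / (2 * Real.pi) := by positivity
    have h3 := hsmallN.le.trans (min_le_right _ _)
    nlinarith
  refine ⟨⟨hN2, hgap, hlogN, hleast⟩, fun W hW => ?_⟩
  have hN2' : (2 : ℝ) < N := by exact_mod_cast hN2
  have hε0 : 0 ≤ besselJ0Inv (Real.sqrt (1 - s)) := hleast.1.1
  have hεW : besselJ0Inv (Real.sqrt (1 - s)) ≤ 2 * Real.pi * W := by
    rw [hthr, one_div, inv_mul_le_iff₀ (by positivity)] at hW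
    exact hW
  have hεs := two_mul_le_besselJ0Inv_sq hs1 hleast
  generalize besselJ0Inv (Real.sqrt (1 - s)) = ε at *
  obtain ⟨I, hIcard, hI⟩ := exists_finset_ports hN2 hr0 hr1
  have hdecorr : ∀ i ∈ I, r ^ 3 * s ≤ 1 - portCorr N W i ^ 2 := by
    intro i hi
    have hfrac : r ≤ (i : ℝ) / ((N : ℝ) - 1) := by
      rw [le_div_iff₀ (by linarith)]
      exact hI i hi
    have ht : r * ε ≤ 2 * Real.pi * (i : ℝ) / ((N : ℝ) - 1) * W := by
      calc r * ε ≤ (i : ℝ) / ((N : ℝ) - 1) * (2 * Real.pi * W) :=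
            mul_le_mul hfrac hεW hε0 (hr0.le.trans hfrac)
        _ = _ := by ring
    have h := hbessel s (hsmallN.le.trans (min_le_left _ _)) _ ((by positivity : 0 ≤ r * ε).trans ht)
      (by
        calc 2 * (r ^ 2 * s) = r ^ 2 * (2 * s) := by ring
          _ ≤ r ^ 2 * ε ^ 2 := by gcongr
          _ = (r * ε) ^ 2 := by ring
          _ ≤ _ := by gcongr)
    calc r ^ 3 * s = r * (r ^ 2 * s) := by ring
      _ ≤ _ := h
  set R := Real.sqrt (l / (κ * r ^ 3)) with hR
  have hR2 : R ^ 2 = l / (κ * r ^ 3) := Real.sq_sqrt (by positivity)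
  have hfas := fasOutage_le (W := W) (γ := γ) hσ hΘ (Real.sqrt_nonneg (l / (κ * r ^ 3))) I
    fun i hi => by
      refine ⟨fun h0 => ?_, lt_of_lt_of_le (by positivity) (hdecorr i hi), ?_⟩
      · have h1 := hI i hi
        rw [h0, Nat.cast_zero] at h1
        nlinarith
      · calc γ / avgSNR σ Θ = l / (κ * r ^ 3) * (r ^ 3 * s) := by
              rw [hsdef, ← hcdef]
              field_simp
          _ ≤ _ := by
              rw [← hR, hR2]
              exact mul_le_mul_of_nonneg_left (hdecorr i hi) (by positivity)
  rw [← hR] at hfas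
  have htail := exp_le_gaussianReal_Ici (Real.sqrt_nonneg (l / (κ * r ^ 3)))
  rw [← hR] at htail
  have hT1 : (gaussianReal 0 (1 / 2 : ℝ≥0)).real (Set.Ici R) ≤ 1 := measureReal_le_one
  generalize (gaussianReal 0 (1 / 2 : ℝ≥0)).real (Set.Ici R) = T at *
  have hMT : C * Real.exp (l - (R + 1) ^ 2) ≤ I.card * T := by
    have hcard : (1 - r) / (2 * K) * Real.exp l ≤ I.card := by
      refine le_trans ?_ hIcard
      calc (1 - r) / (2 * K) * Real.exp l ≤ (1 - r) / (2 * K) * (K * N) := by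
            have : 0 < 1 - r := by linarith
            gcongr
        _ = (1 - r) * (N / 2) := by field_simp
        _ ≤ _ := mul_le_mul_of_nonneg_left (by linarith) (by linarith)
    calc C * Real.exp (l - (R + 1) ^ 2) = ((1 - r) / (2 * K) * Real.exp l) *
          ((Real.sqrt Real.pi)⁻¹ * Real.exp (-(R + 1) ^ 2)) := by
          rw [sub_eq_add_neg, Real.exp_add]
          simp only [C]
          ring
      _ ≤ I.card * T := by gcongr
  calc fasOutage N W σ Θ γ ≤ 2 * (1 - T) ^ I.card := hfas
    _ ≤ 2 * Real.exp (-T) ^ I.card := by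
        have h0 : 0 ≤ 1 - T := by linarith
        gcongr
        exact Real.one_sub_le_exp_neg T
    _ = 2 * Real.exp (-(I.card * T)) := by rw [← Real.exp_nat_mul, mul_neg]
    _ < 2 * Real.exp (-Real.log (2 / p)) := by
        have := hbigN.trans_le hMT
        gcongr
    _ = p := by
        rw [Real.exp_neg, Real.exp_log (by positivity)]
        field_simp
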